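/- For a set $P\subseteq\mathbb{R}^d$ that is finite, or non-empty and compact, and $u\in\mathbb{R}^d$ let $f(P,u)=\max_{p\in P}\langle u,p\rangle$ and let $\omega(P,u)=f(P,u)+f(P,-u)$ be the directional width, with $\omega(\emptyset,u)=0$. Let $\mathcal{P}$ be a set of $n$ stochastic points in $\mathbb{R}^d$, in one of two models. In the existential model, each point $v$ has a fixed location and is present, independently of the others, with a given probability $p_v\in[0,1]$. In the locational model, every point is present, and each point $v$ lies, independently of the others, at location $s$ with a given probability $p_{v,s}$, where $s$ ranges over a finite set of possible locations and $\sum_s p_{v,s}=1$. Write $P\sim\mathcal{P}$ for the random realization of $\mathcal{P}$ and $\omega(\mathcal{P},u)=\mathbb{E}_{P\sim\mathcal{P}}[\omega(P,u)]$ for the expected directional width. A set $S$ of deterministic points is an $\varepsilon$-exp-kernel of $\mathcal{P}$ if $(1-\varepsilon)\,\omega(\mathcal{P},u)\le\omega(S,u)\le\omega(\mathcal{P},u)$ for all $u\in\mathbb{R}^d$. (1) Let $M=\sum_{P}\Pr[P]\cdot\mathrm{ConvH}(P)$ be the Minkowski sum over all realizations $P$ of $\mathcal{P}$, where the empty realization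 contributes $\{0\}$. Then $\omega(M,u)=\omega(\mathcal{P},u)$ for all $u\in\mathbb{R}^d$. Moreover $M$ is a convex polytope, i.e. $M=\mathrm{ConvH}(V)$ for a finite non-empty set $V\subset\mathbb{R}^d$ of deterministic points, and $\omega(V,u)=\omega(\mathcal{P},u)$ for all $u\in\mathbb{R}^d$. (2) For every $d$ there is a constant $C>0$, depending only on $d$, such that for every $n$, every set $\mathcal{P}$ of $n$ stochastic points in $\mathbb{R}^d$ in the existential or the locational model, and every $\varepsilon>0$, there is a non-empty set $S$ of at most $C\max\{1,1/\varepsilon^{(d-1)/2}\}$ deterministic points in $\mathbb{R}^d$ (not required to be a subset of the points of $\mathcal{P}$) that is an $\varepsilon$-exp-kernel of $\mathcal{P}$. -/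

import Mathlib

open scoped Pointwise

namespace StochasticPoints

/-- Euclidean space `ℝ^d` with its usual inner product. -/
abbrev Space (d : ℕ) : Type := EuclideanSpace ℝ (Fin d)

/-- The support function `f(P, u) = max_{p ∈ P} ⟨u, p⟩`, written as a supremum so that it also
applies to infinite compact sets. For `P = ∅` its value is `0`. -/
noncomputable def supportFn {d : ℕ} (P : Set (Space d)) (u : Space d) : ℝ :=
  sSup ((fun p => inner ℝ u p) '' P)

/-- The directional width `ω(P, u) = f(P, u) + f(P, -u)`. In particular `ω(∅, u) = 0`. -/
noncomputable def dirWidth {d : ℕ} (P : Set (Space d)) (u : Space d) : ℝ :=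
  supportFn P u + supportFn P (-u)

/-- A random finite point set with finitely many outcomes: outcome `ω` has probability `pr ω`
and yields the deterministic finite point set `realize ω`. -/
structure RandomPointSet (d : ℕ) where
  Outcome : Type
  fintypeOutcome : Fintype Outcome
  pr : Outcome → ℝ
  realize : Outcome → Set (Space d)
  finite_realize : ∀ ω, (realize ω).Finite
  pr_nonneg : ∀ ω, 0 ≤ pr ω
  sum_pr : ∑ ω, pr ω = 1

attribute [instance] RandomPointSet.fintypeOutcome

/-- The existential uncertainty model: `n` points with fixed locations (coincidences allowed),
point `i` being present, independently of the others, with probability `prob i`. -/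
structure ExistentialModel (d n : ℕ) where
  loc : Fin n → Space d
  prob : Fin n → ℝ
  prob_nonneg : ∀ i, 0 ≤ prob i
  prob_le_one : ∀ i, prob i ≤ 1

/-- The locational uncertainty model: `n` points, all of them present; point `i` lies,
independently of the others, at location `s` with probability `prob i s`, where `s` ranges over
a finite set `locs` of possible locations. -/
structure LocationalModel (d n : ℕ) where
  locs : Finset (Space d)
  prob : Fin n → locs → ℝ
  prob_nonneg : ∀ i s, 0 ≤ prob i s
  sum_prob : ∀ i, ∑ s, prob i s = 1

/-- The random point set of the existential model: the outcome is the set `A` of the points that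
are present, and its probability is `∏_{i ∈ A} p_i ∏_{i ∉ A} (1 - p_i)`. -/
noncomputable def ExistentialModel.law {d n : ℕ} (X : ExistentialModel d n) :
    RandomPointSet d where
  Outcome := Finset (Fin n)
  fintypeOutcome := inferInstance
  pr A := (∏ i ∈ A, X.prob i) * ∏ i ∈ Aᶜ, (1 - X.prob i)
  realize A := X.loc '' (A : Set (Fin n))
  finite_realize A := A.finite_toSet.image _
  pr_nonneg A := mul_nonneg (Finset.prod_nonneg fun i _ => X.prob_nonneg i)
    (Finset.prod_nonneg fun i _ => sub_nonneg.2 (X.prob_le_one i))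
  sum_pr := by
    rw [← Fintype.prod_add]
    simp

/-- The random point set of the locational model: the outcome is the assignment `σ` of a location
to every point, and its probability is `∏_i p_{i, σ(i)}`. -/
noncomputable def LocationalModel.law {d n : ℕ} (X : LocationalModel d n) :
    RandomPointSet d where
  Outcome := Fin n → X.locs
  fintypeOutcome := inferInstance
  pr σ := ∏ i, X.prob i (σ i)
  realize σ := Set.range fun i => (σ i : Space d)
  finite_realize σ := Set.finite_range _
  pr_nonneg σ := Finset.prod_nonneg fun i _ => X.prob_nonneg i (σ i)
  sum_pr := by
    rw [← Fintype.prod_sum]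
    exact Finset.prod_eq_one fun i _ => X.sum_prob i

/-- A set of `n` stochastic points in `ℝ^d`, in one of the two uncertainty models. -/
inductive Model (d n : ℕ) where
  | existential (X : ExistentialModel d n)
  | locational (X : LocationalModel d n)

/-- The random realization `P ∼ 𝒫` of a set of stochastic points. -/
noncomputable def Model.law {d n : ℕ} : Model d n → RandomPointSet d
  | .existential X => X.law
  | .locational X => X.law

/-- The expected directional width `ω(𝒫, u) = E_{P ∼ 𝒫} [ω(P, u)]`. -/
noncomputable def Model.expWidth {d n : ℕ} (X : Model d n) (u : Space d) : ℝ :=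
  ∑ ω, X.law.pr ω * dirWidth (X.law.realize ω) u

open scoped Classical in
/-- The Minkowski sum `M = ∑_P Pr[P] · ConvH(P)` over the realizations. The empty realization,
which can occur in the existential model and has width zero, contributes `{0}`, that is, it is
left out of the sum (an empty sum is `{0}`). -/
noncomputable def Model.minkowskiSum {d n : ℕ} (X : Model d n) : Set (Space d) :=
  ∑ ω with (X.law.realize ω).Nonempty, X.law.pr ω • convexHull ℝ (X.law.realize ω)

/-- `S` is an `ε`-exp-kernel of `X`, for a set `S` of deterministic points. -/
def IsExpKernel {d n : ℕ} (ε : ℝ) (S : Set (Space d)) (X : Model d n) : Prop :=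
  ∀ u : Space d, (1 - ε) * X.expWidth u ≤ dirWidth S u ∧ dirWidth S u ≤ X.expWidth u

end StochasticPoints

/-!
The support function `P ↦ f(P, u)` is additive under Minkowski sums, homogeneous under scaling by
nonnegative numbers, and unchanged by passing to the convex hull. Taking convex hulls also commutes
with sums and scalings. Hence the Minkowski sum `M` of the weighted hulls of the realizations is
the hull of the finite set `V = ∑ Pr[P] • P` (the sum over the nonempty realizations), and the
widths of `M` and `V` are the expected width (`Model.exists_finset_minkowskiSum_eq`). Part (2)
thereby reduces to the existence of small kernels of a finite set `V`.

Two ideas give such kernels. The first is a normalization that replaces the Löwner–John ellipsoid: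
among the frames formed by points of `V`, one of largest volume has the property that all of `V`
has coordinates in `[-1, 1]` (`exists_barycentric_spanner`). In these coordinates the hull of `V`
becomes a convex set `K` inside a cube. The frame consists of points of `V`, so the width of `V`
bounds every coordinate of the transformed direction. It is therefore enough to approximate `K` up
to an error of order `ε`, relative to the norm of that direction. The dimension `k ≤ d` of the
frame is that of the affine span of `V`, so degenerate sets need no separate treatment.

The second is Dudley's construction (`exists_finset_almost_extreme`). A net of mesh `δ` on the
boundary of a larger cube has `O(δ ^ (-(k - 1)))` points, and the nearest points of `K` to the
points of the net approximate the support function of `K` up to `O(δ ^ 2)`. The reason for the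
second order is the inequality `inner_sub_le_of_nearest`. The choice `δ ∼ √ε` yields the claimed
size.
-/

namespace StochasticPoints

/-! ### Support functions and widths of finite sets -/

section Support

variable {d : ℕ}

theorem bddAbove_inner_image {P : Set (Space d)} (hP : P.Finite) (u : Space d) :
    BddAbove ((fun p => inner ℝ u p) '' P) :=
  (hP.image _).bddAbove

theorem inner_le_supportFn {P : Set (Space d)} (hP : P.Finite) (u : Space d) {p : Space d}
    (hp : p ∈ P) : inner ℝ u p ≤ supportFn P u :=
  le_csSup (bddAbove_inner_image hP u) ⟨p, hp, rfl⟩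

theorem supportFn_le {P : Set (Space d)} (hP : P.Nonempty) {u : Space d} {a : ℝ}
    (h : ∀ p ∈ P, inner ℝ u p ≤ a) : supportFn P u ≤ a :=
  csSup_le (hP.image _) (by rintro _ ⟨p, hp, rfl⟩; exact h p hp)

theorem exists_inner_eq_supportFn {P : Set (Space d)} (hP : P.Finite) (hne : P.Nonempty)
    (u : Space d) : ∃ p ∈ P, inner ℝ u p = supportFn P u :=
  (hne.image _).csSup_mem (hP.image _)

theorem inner_le_supportFn_of_mem_convexHull {P : Set (Space d)} (hP : P.Finite) (u : Space d)
    {x : Space d} (hx : x ∈ convexHull ℝ P) : inner ℝ u x ≤ supportFn P u := by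
  have hconv : Convex ℝ {x : Space d | inner ℝ u x ≤ supportFn P u} :=
    convex_halfSpace_le (innerₗ (Space d) u).isLinear _
  exact convexHull_min (fun p hp => inner_le_supportFn hP u hp) hconv hx

theorem supportFn_convexHull {P : Set (Space d)} (hP : P.Finite) (hne : P.Nonempty)
    (u : Space d) : supportFn (convexHull ℝ P) u = supportFn P u := by
  refine le_antisymm (supportFn_le hne.convexHull fun x hx =>
    inner_le_supportFn_of_mem_convexHull hP u hx) ?_
  refine csSup_le_csSup ⟨supportFn P u, ?_⟩ (hne.image _)
    (Set.image_mono (subset_convexHull ℝ P))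
  rintro _ ⟨x, hx, rfl⟩
  exact inner_le_supportFn_of_mem_convexHull hP u hx

theorem supportFn_empty (u : Space d) : supportFn (∅ : Set (Space d)) u = 0 := by
  simp [supportFn]

theorem supportFn_zero (u : Space d) : supportFn (0 : Set (Space d)) u = 0 := by
  simp [supportFn, ← Set.singleton_zero]

theorem supportFn_smul {c : ℝ} (hc : 0 ≤ c) (P : Set (Space d)) (u : Space d) :
    supportFn (c • P) u = c * supportFn P u := by
  have h : (fun p => inner ℝ u p) '' (c • P) = c • ((fun p : Space d => inner ℝ u p) '' P) :=
    Set.image_smul_comm _ c P fun p => inner_smul_right u p c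
  rw [supportFn, h, Real.sSup_smul_of_nonneg hc, smul_eq_mul, supportFn]

theorem supportFn_add {P Q : Set (Space d)} (hP : P.Finite) (hPne : P.Nonempty) (hQ : Q.Finite)
    (hQne : Q.Nonempty) (u : Space d) : supportFn (P + Q) u = supportFn P u + supportFn Q u := by
  have h : (fun p => inner ℝ u p) '' (P + Q) =
      (fun p : Space d => inner ℝ u p) '' P + (fun p : Space d => inner ℝ u p) '' Q :=
    Set.image_add (innerₗ (Space d) u)
  rw [supportFn, h, csSup_add (hPne.image _) (bddAbove_inner_image hP u) (hQne.image _)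
    (bddAbove_inner_image hQ u), supportFn, supportFn]

theorem finite_nonempty_supportFn_sum {ι : Type*} (s : Finset ι) (T : ι → Set (Space d))
    (hT : ∀ i ∈ s, (T i).Finite ∧ (T i).Nonempty) :
    (∑ i ∈ s, T i).Finite ∧ (∑ i ∈ s, T i).Nonempty ∧
      ∀ u, supportFn (∑ i ∈ s, T i) u = ∑ i ∈ s, supportFn (T i) u := by
  classical
  induction s using Finset.induction_on with
  | empty => simp [supportFn_zero]
  | insert a s ha ih =>
    obtain ⟨h1, h2, h3⟩ := ih fun i hi => hT i (Finset.mem_insert_of_mem hi)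
    obtain ⟨ha1, ha2⟩ := hT a (Finset.mem_insert_self a s)
    simp only [Finset.sum_insert ha]
    exact ⟨ha1.add h1, ha2.add h2, fun u => by rw [supportFn_add ha1 ha2 h1 h2, h3]⟩

theorem abs_inner_sub_le_dirWidth {P : Set (Space d)} (hP : P.Finite) (u : Space d)
    {p q : Space d} (hp : p ∈ P) (hq : q ∈ P) : |inner ℝ u (p - q)| ≤ dirWidth P u := by
  have h1 := inner_le_supportFn hP u hp
  have h2 := inner_le_supportFn hP u hq
  have h3 := inner_le_supportFn hP (-u) hp
  have h4 := inner_le_supportFn hP (-u) hq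
  rw [inner_neg_left] at h3 h4
  rw [inner_sub_right, abs_le, dirWidth]
  constructor <;> linarith

theorem dirWidth_nonneg {P : Set (Space d)} (hP : P.Finite) (hne : P.Nonempty) (u : Space d) :
    0 ≤ dirWidth P u := by
  obtain ⟨p, hp⟩ := hne
  exact (abs_nonneg _).trans (abs_inner_sub_le_dirWidth hP u hp hp)

end Support

/-! ### The expected width as the width of a polytope -/

open scoped Classical in
theorem Model.exists_finset_minkowskiSum_eq {d n : ℕ} (X : Model d n) :
    ∃ V : Finset (Space d), V.Nonempty ∧ X.minkowskiSum = convexHull ℝ (V : Set (Space d)) ∧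
      ∀ u, dirWidth (V : Set (Space d)) u = X.expWidth u := by
  set s : Finset X.law.Outcome := {ω | (X.law.realize ω).Nonempty} with hs
  obtain ⟨h1, h2, h3⟩ := finite_nonempty_supportFn_sum s
    (fun ω => X.law.pr ω • X.law.realize ω) fun ω hω =>
      ⟨(X.law.finite_realize ω).smul_set, (Finset.mem_filter.1 hω).2.smul_set⟩
  refine ⟨h1.toFinset, by simpa using h2, ?_, fun u => ?_⟩
  · rw [h1.coe_toFinset, convexHull_sum]
    simp only [convexHull_smul]
    rfl
  · rw [h1.coe_toFinset, dirWidth, h3, h3, ← Finset.sum_add_distrib, Model.expWidth]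
    -- The empty realizations are left out of the Minkowski sum; their width is zero.
    refine Finset.sum_subset_zero_on_sdiff (Finset.subset_univ s) (fun ω hω => ?_)
      fun ω _ => ?_
    · have hempty : X.law.realize ω = ∅ := by
        simpa [hs, Set.not_nonempty_iff_eq_empty] using hω
      simp [hempty, dirWidth, supportFn_empty]
    · rw [supportFn_smul (X.law.pr_nonneg ω), supportFn_smul (X.law.pr_nonneg ω), dirWidth, mul_add]

/-! ### Barycentric spanners -/

/-- A finite nonempty set `V` contains a point `b₀` and points `b₁, …, bₖ` such that every point of
`V` has coordinates in `[-1, 1]` with respect to the frame `b₀; b₁ - b₀, …, bₖ - b₀`. The frame is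
one of largest volume in the affine span of `V`; by Cramer's rule a coordinate of a point is then
a ratio of two determinants, the denominator being the largest one. -/
theorem exists_barycentric_spanner {E : Type*} [AddCommGroup E] [Module ℝ E]
    [FiniteDimensional ℝ E] (V : Finset E) (hV : V.Nonempty) :
    ∃ k : ℕ, k ≤ Module.finrank ℝ E ∧ ∃ b₀ ∈ V, ∃ b : Fin k → E, (∀ i, b i ∈ V) ∧
      ∀ v ∈ V, ∃ c : Fin k → ℝ, (∀ i, |c i| ≤ 1) ∧ v = b₀ + ∑ i, c i • (b i - b₀) := by
  obtain ⟨b₀, hb₀⟩ := hV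
  set D : Set E := (fun v => v - b₀) '' (V : Set E) with hD
  set W := Submodule.span ℝ D with hW
  have hmem : ∀ v : V, (v : E) - b₀ ∈ W := fun v => Submodule.subset_span ⟨v, v.2, rfl⟩
  let g : V → W := fun v => ⟨v - b₀, hmem v⟩
  have hspan : Submodule.span ℝ (Set.range g) = ⊤ := by
    have hrange : (W.subtype : W → E) '' Set.range g = D := by
      rw [← Set.range_comp]
      ext x
      simp [hD, g]
    apply Submodule.map_injective_of_injective W.injective_subtype
    rw [Submodule.map_span, hrange, Submodule.map_top, Submodule.range_subtype]
  obtain ⟨T, hT, hTspan, hTli⟩ := exists_linearIndependent ℝ (Set.range g)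
  have hTtop : ⊤ ≤ Submodule.span ℝ (Set.range ((↑) : T → W)) := by
    rw [Subtype.range_coe, hTspan, hspan]
  let e₁ := Module.Basis.mk hTli hTtop
  have : Fintype T := FiniteDimensional.fintypeBasisIndex e₁
  let e := e₁.reindex (Fintype.equivFin T)
  have he : ∀ i, ∃ v : V, g v = e i := fun i => by
    obtain ⟨v, hv⟩ := hT ((Fintype.equivFin T).symm i).2
    exact ⟨v, by simp [e, e₁, hv]⟩
  choose f₀ hf₀ using he
  have : Nonempty (Fin (Fintype.card T) → V) := ⟨f₀⟩
  obtain ⟨f, hf⟩ := Finite.exists_max fun f : Fin (Fintype.card T) → V => |e.det (g ∘ f)|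
  -- The basis `e` itself consists of differences of points of `V`, so the maximum is positive.
  have hdet : 1 ≤ |e.det (g ∘ f)| := by
    have h := hf f₀
    have h0 : g ∘ f₀ = e := funext hf₀
    rwa [h0, Module.Basis.det_self, abs_one] at h
  have hpos : 0 < |e.det (g ∘ f)| := by linarith
  obtain ⟨hli, hsp⟩ := (Module.Basis.is_basis_iff_det e).2 (abs_pos.1 hpos).isUnit
  let B := Module.Basis.mk hli hsp.ge
  refine ⟨Fintype.card T, ?_, b₀, hb₀, fun i => f i, fun i => (f i).2, fun v hv =>
    ⟨fun i => B.coord i (g ⟨v, hv⟩), fun i => ?_, ?_⟩⟩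
  · rw [← Module.finrank_eq_card_basis e₁]
    exact Submodule.finrank_le W
  · have h := congrArg (fun φ => |φ (g ⟨v, hv⟩)|)
      (Module.Basis.det_smul_mk_coord_eq_det_update e hli hsp.ge i)
    simp only [LinearMap.smul_apply, smul_eq_mul, abs_mul] at h
    have hupd : Function.update (g ∘ f) i (g ⟨v, hv⟩) = g ∘ Function.update f i ⟨v, hv⟩ :=
      (Function.comp_update g f i _).symm
    have hle : |e.det (Function.update (g ∘ f) i (g ⟨v, hv⟩))| ≤ |e.det (g ∘ f)| := by
      rw [hupd]
      exact hf _
    refine le_of_mul_le_mul_left ?_ hpos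
    rw [mul_one]
    exact h.trans_le hle
  · have h := congrArg (W.subtype) (B.sum_repr (g ⟨v, hv⟩))
    simp only [map_sum, map_smul] at h
    simp only [B, Module.Basis.mk_apply, Function.comp, Submodule.subtype_apply, g] at h
    rw [← sub_eq_iff_eq_add', ← h]
    rfl

/-! ### A net on the boundary of a cube -/

theorem exists_grid_point_near {m : ℕ} (hm : 1 ≤ m) {z : ℝ} (hz : |z| ≤ 2) :
    ∃ a : Fin (m + 1), |z - (-2 + 4 * (a : ℕ) / m)| ≤ 4 / m := by
  obtain ⟨hz1, hz2⟩ := abs_le.1 hz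
  have hm0 : (0 : ℝ) < m := by exact_mod_cast hm
  set t : ℝ := (z + 2) * m / 4 with ht
  have ht0 : 0 ≤ t := div_nonneg (mul_nonneg (by linarith) hm0.le) (by norm_num)
  have htm : t ≤ m := by rw [ht]; nlinarith
  have hfl : ⌊t⌋₊ ≤ m := by simpa using Nat.floor_le_floor htm
  refine ⟨⟨⌊t⌋₊, by omega⟩, ?_⟩
  have h1 := Nat.floor_le ht0
  have h2 := Nat.lt_floor_add_one t
  have hz' : z - (-2 + 4 * (⌊t⌋₊ : ℝ) / m) = 4 * (t - ⌊t⌋₊) / m := by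
    rw [ht]
    field_simp
    ring
  simp only [hz']
  rw [abs_of_nonneg (div_nonneg (by linarith) hm0.le)]
  gcongr
  linarith

/-- The boundary of the cube `[-2, 2]^k` has dimension `k - 1`: on each of its `2k` facets, a grid
with `(m + 1) ^ (k - 1)` points comes within `4 / m` of every point in each coordinate. -/
theorem exists_net_cube_boundary (k : ℕ) {m : ℕ} (hm : 1 ≤ m) :
    ∃ N : Finset (Space k), N.card ≤ 2 * k * (m + 1) ^ (k - 1) ∧
      ∀ z : Space k, (∀ j, |z j| ≤ 2) → (∃ i, |z i| = 2) →
        ∃ y ∈ N, ‖z - y‖ ^ 2 ≤ 16 * k / (m : ℝ) ^ 2 := by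
  classical
  let F : (Σ i : Fin k, Bool × ({j // j ≠ i} → Fin (m + 1))) → Space k := fun x =>
    WithLp.toLp 2 fun j => if h : j = x.1 then (if x.2.1 then 2 else -2)
      else -2 + 4 * ((x.2.2 ⟨j, h⟩ : ℕ) : ℝ) / m
  refine ⟨Finset.univ.image F, Finset.card_image_le.trans ?_, fun z hz ⟨i, hi⟩ => ?_⟩
  · simp [Fintype.card_sigma, Fintype.card_subtype_compl]
    exact le_of_eq (by ring)
  · choose a ha using fun j => exists_grid_point_near hm (hz j)
    refine ⟨_, Finset.mem_image_of_mem F (Finset.mem_univ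
      (⟨i, decide (z i = 2), fun j => a j⟩ :
        Σ i : Fin k, Bool × ({j // j ≠ i} → Fin (m + 1)))), ?_⟩
    rw [EuclideanSpace.norm_sq_eq]
    have hle : ∀ j : Fin k, ‖(z - F ⟨i, decide (z i = 2), fun j => a j⟩) j‖ ^ 2 ≤
        16 / (m : ℝ) ^ 2 := by
      intro j
      have h16 : (16 : ℝ) / (m : ℝ) ^ 2 = (4 / m) ^ 2 := by rw [div_pow]; norm_num
      rw [h16, Real.norm_eq_abs]
      gcongr
      by_cases hj : j = i
      · subst hj
        have h0 : (0 : ℝ) ≤ 4 / m := by positivity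
        rcases (abs_eq (by norm_num : (0 : ℝ) ≤ 2)).1 hi with h | h
        · simpa [F, h] using h0
        · have hne : ¬ ((-2 : ℝ) = 2) := by norm_num
          simpa [F, h, hne] using h0
      · simpa [F, hj] using ha j
    calc _ ≤ ∑ _j : Fin k, 16 / (m : ℝ) ^ 2 := Finset.sum_le_sum fun j _ => hle j
      _ = 16 * k / (m : ℝ) ^ 2 := by simp; ring

/-! ### Nearest points of a net and approximation of extreme points -/

/-- A ray that starts in the cube `[-1, 1]^k` meets the boundary of `[-2, 2]^k`, and it has length
at least `1` up to there. -/
theorem exists_ray_mem_cube_boundary {k : ℕ} {p w : Space k} (hp : ∀ j, |p j| ≤ 1) (hw : w ≠ 0) :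
    ∃ t : ℝ, 0 ≤ t ∧ 1 ≤ t * ‖w‖ ∧ (∀ j, |(p + t • w) j| ≤ 2) ∧ ∃ i, |(p + t • w) i| = 2 := by
  obtain ⟨i₀, hi₀⟩ : ∃ i, w i ≠ 0 := by
    by_contra! h
    exact hw (by ext i; simpa using h i)
  have : Nonempty (Fin k) := ⟨i₀⟩
  let φ : ℝ → ℝ := fun t => ‖fun j => p j + t * w j‖
  have hφ : Continuous φ := by fun_prop
  have hwpos : 0 < |w i₀| := abs_pos.2 hi₀
  have hT0 : 0 ≤ 3 / |w i₀| := by positivity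
  have h0 : φ 0 ≤ 2 := by
    refine (pi_norm_le_iff_of_nonneg (by norm_num)).2 fun j => ?_
    simpa using (hp j).trans (by norm_num)
  have hT : 2 ≤ φ (3 / |w i₀|) := by
    refine le_trans ?_ (norm_le_pi_norm (fun j => p j + 3 / |w i₀| * w j) i₀)
    have h1 : |3 / |w i₀| * w i₀| = 3 := by
      rw [abs_mul, abs_of_nonneg hT0, div_mul_cancel₀ _ hwpos.ne']
    have h2 := abs_sub_abs_le_abs_sub (3 / |w i₀| * w i₀) (-p i₀)
    rw [h1, abs_neg, sub_neg_eq_add, add_comm _ (p i₀)] at h2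
    rw [Real.norm_eq_abs]
    linarith [hp i₀]
  -- `φ` is the sup norm along the ray, so `φ t = 2` says that the ray is on the boundary at `t`.
  obtain ⟨t, ⟨ht0, -⟩, ht⟩ := intermediate_value_Icc hT0 hφ.continuousOn ⟨h0, hT⟩
  obtain ⟨i, hi⟩ : ∃ i, ‖p i + t * w i‖ = 2 := by
    obtain ⟨i, hi⟩ := Finite.exists_max fun j => ‖p j + t * w j‖
    refine ⟨i, le_antisymm (ht ▸ norm_le_pi_norm (fun j => p j + t * w j) i) ?_⟩
    rw [← ht]
    exact (pi_norm_le_iff_of_nonneg (norm_nonneg _)).2 hi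
  refine ⟨t, ht0, ?_, fun j => ?_, i, by simpa using hi⟩
  · have h1 := abs_add_le (p i) (t * w i)
    rw [← Real.norm_eq_abs, hi, abs_mul, abs_of_nonneg ht0] at h1
    have h2 : |w i| ≤ ‖w‖ := PiLp.norm_apply_le w i
    nlinarith [hp i, mul_le_mul_of_nonneg_left h2 ht0]
  · have := norm_le_pi_norm (fun j => p j + t * w j) j
    simpa [← ht] using this

/-- Let `q` be the nearest point of a convex set to `y`, and let `p` be a point of that set. For
every point `z`, the inner product of `z - p` with `p - q` is of second order in the distance from
`y` to `z`. -/
theorem inner_sub_le_of_nearest {E : Type*} [NormedAddCommGroup E] [InnerProductSpace ℝ E]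
    {y z p q : E} (hq : inner ℝ (y - q) (p - q) ≤ 0) :
    inner ℝ (z - p) (p - q) ≤ ‖z - y‖ ^ 2 / 4 := by
  have h1 : inner ℝ (z - p) (p - q) =
      inner ℝ (z - y) (p - q) + inner ℝ (y - q) (p - q) - inner ℝ (p - q) (p - q) := by
    rw [← inner_add_left, ← inner_sub_left]
    congr 1
    abel
  have h2 := real_inner_le_norm (z - y) (p - q)
  rw [h1, real_inner_self_eq_norm_sq]
  -- With `a = ‖z - y‖` and `b = ‖p - q‖` the bound is `a * b - b ^ 2 ≤ a ^ 2 / 4`.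
  nlinarith [sq_nonneg (‖z - y‖ / 2 - ‖p - q‖)]

/-- Dudley's approximation of a convex set `K` in the cube `[-1, 1]^k`: the nearest points in `K`
of a net on the boundary of a larger cube contain, for every direction `w`, an almost extreme
point. If `p` is extreme in direction `w`, then the ray from `p` in direction `w` leaves the larger
cube close to a point `y` of the net, and the nearest point to `y` has the required property. -/
theorem exists_finset_almost_extreme {k : ℕ} {K : Set (Space k)} (hne : K.Nonempty)
    (hclosed : IsClosed K) (hconv : Convex ℝ K) (hcube : ∀ p ∈ K, ∀ j, |p j| ≤ 1) {m : ℕ}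
    (hm : 1 ≤ m) :
    ∃ S : Finset (Space k), S.Nonempty ∧ (S : Set (Space k)) ⊆ K ∧
      S.card ≤ 2 * k * (m + 1) ^ (k - 1) + 1 ∧
      ∀ w : Space k, ∀ p ∈ K, (∀ x ∈ K, inner ℝ w x ≤ inner ℝ w p) →
        ∃ q ∈ S, inner ℝ w p - inner ℝ w q ≤ 4 * k / (m : ℝ) ^ 2 * ‖w‖ := by
  classical
  have hproj : ∀ y : Space k, ∃ q ∈ K, ∀ x ∈ K, inner ℝ (y - q) (x - q) ≤ 0 := fun y => by
    obtain ⟨q, hq, h⟩ := exists_norm_eq_iInf_of_complete_convex hne hclosed.isComplete hconv y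
    exact ⟨q, hq, (norm_eq_iInf_iff_real_inner_le_zero hconv hq).1 h⟩
  choose π hπK hπ using hproj
  obtain ⟨N, hcard, hN⟩ := exists_net_cube_boundary k hm
  obtain ⟨p₀, hp₀⟩ := hne
  refine ⟨insert p₀ (N.image π), Finset.insert_nonempty _ _, ?_, ?_, fun w p hp hmax => ?_⟩
  · intro x hx
    rcases Finset.mem_insert.1 hx with rfl | hx
    · exact hp₀
    · obtain ⟨y, -, rfl⟩ := Finset.mem_image.1 hx
      exact hπK y
  · exact (Finset.card_insert_le _ _).trans
      (Nat.add_le_add_right (Finset.card_image_le.trans hcard) 1)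
  · rcases eq_or_ne w 0 with rfl | hw
    · exact ⟨p₀, Finset.mem_insert_self _ _, by simp⟩
    obtain ⟨t, ht0, ht1, hz, hzi⟩ := exists_ray_mem_cube_boundary (hcube p hp) hw
    obtain ⟨y, hy, hzy⟩ := hN _ hz hzi
    refine ⟨π y, Finset.mem_insert_of_mem (Finset.mem_image_of_mem π hy), ?_⟩
    have h1 := inner_sub_le_of_nearest (z := p + t • w) (hπ y p hp)
    rw [add_sub_cancel_left, real_inner_smul_left, inner_sub_right] at h1
    have h2 : t * (inner ℝ w p - inner ℝ w (π y)) ≤ 4 * k / (m : ℝ) ^ 2 :=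
      h1.trans (by linarith [show 16 * (k : ℝ) / (m : ℝ) ^ 2 = 4 * (4 * k / (m : ℝ) ^ 2) by ring])
    have h3 : 0 ≤ inner ℝ w p - inner ℝ w (π y) := sub_nonneg.2 (hmax _ (hπK y))
    calc inner ℝ w p - inner ℝ w (π y)
        ≤ (t * ‖w‖) * (inner ℝ w p - inner ℝ w (π y)) := le_mul_of_one_le_left h3 ht1
      _ = t * (inner ℝ w p - inner ℝ w (π y)) * ‖w‖ := by ring
      _ ≤ 4 * k / (m : ℝ) ^ 2 * ‖w‖ := mul_le_mul_of_nonneg_right h2 (norm_nonneg w)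

/-! ### Kernels of finite sets -/

/-- In the coordinates of a barycentric spanner the hull of `V` is a convex set `K` in the cube
`[-1, 1]^k`, and a direction `u` becomes a direction `w` all of whose coordinates `⟨u, bᵢ - b₀⟩` are
bounded by the width of `V`. Hence an error of order `‖w‖` in the approximation of `K` is small
relative to that width. -/
theorem exists_finset_dirWidth_sub_le {d : ℕ} (V : Finset (Space d)) (hV : V.Nonempty) {m : ℕ}
    (hm : 1 ≤ m) :
    ∃ S : Finset (Space d), S.Nonempty ∧ S.card ≤ 2 * d * (m + 1) ^ (d - 1) + 1 ∧
      ∀ u, dirWidth (S : Set (Space d)) u ≤ dirWidth (V : Set (Space d)) u ∧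
        dirWidth (V : Set (Space d)) u - dirWidth (S : Set (Space d)) u ≤
          8 * (d : ℝ) ^ 2 / (m : ℝ) ^ 2 * dirWidth (V : Set (Space d)) u := by
  classical
  have hVne : (V : Set (Space d)).Nonempty := hV
  have hVfin := V.finite_toSet
  obtain ⟨k, hk, b₀, hb₀, b, hb, hc⟩ := exists_barycentric_spanner V hV
  rw [finrank_euclideanSpace_fin] at hk
  let A : Space k → Space d := fun x => b₀ + ∑ i, x i • (b i - b₀)
  let W : Space d → Space k := fun u => WithLp.toLp 2 fun i => inner ℝ u (b i - b₀)
  have hA : ∀ u x, inner ℝ u (A x) = inner ℝ u b₀ + inner ℝ (W u) x := fun u x => by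
    have hWx : inner ℝ (W u) x = ∑ i, x i * inner ℝ u (b i - b₀) := by
      rw [PiLp.inner_apply]
      rfl
    simp only [A, hWx, inner_add_right, inner_sum, real_inner_smul_right]
  have hAcont : Continuous A := by fun_prop
  -- `K` is the hull of `V` in the coordinates of the frame, cut off at the cube. By the choice of
  -- the frame it contains coordinates for every point of `V`, so `A` still maps it onto the hull.
  let K : Set (Space k) := {x | (∀ j, |x j| ≤ 1) ∧ A x ∈ convexHull ℝ (V : Set (Space d))}
  have hlift : ∀ v ∈ V, ∃ x ∈ K, A x = v := fun v hv => by
    obtain ⟨c, hc1, hcv⟩ := hc v hv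
    have hAc : A (WithLp.toLp 2 c) = v := hcv.symm
    exact ⟨WithLp.toLp 2 c, ⟨hc1, hAc ▸ subset_convexHull ℝ _ hv⟩, hAc⟩
  have hKclosed : IsClosed K := by
    have hcube : IsClosed {x : Space k | ∀ j, |x j| ≤ 1} := by
      rw [Set.ofPred_forall]
      exact isClosed_iInter fun j => isClosed_le (by fun_prop) continuous_const
    exact hcube.inter ((hVfin.isCompact_convexHull ℝ).isClosed.preimage hAcont)
  have hKconv : Convex ℝ K := by
    intro x hx y hy s t hs ht hst
    refine ⟨fun j => ?_, ?_⟩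
    · have hconv : Convex ℝ (Set.Icc (-1 : ℝ) 1) := convex_Icc _ _
      exact abs_le.2 (hconv (abs_le.1 (hx.1 j)) (abs_le.1 (hy.1 j)) hs ht hst)
    · have hAst : A (s • x + t • y) = s • A x + t • A y := by
        simp only [A, PiLp.add_apply, PiLp.smul_apply, smul_eq_mul, add_smul, mul_smul,
          Finset.sum_add_distrib, smul_add, Finset.smul_sum]
        nth_rewrite 1 [← one_smul ℝ b₀]
        rw [← hst, add_smul]
        abel
      rw [hAst]
      exact convex_convexHull ℝ _ hx.2 hy.2 hs ht hst
  have hKne : K.Nonempty := by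
    obtain ⟨x, hx, -⟩ := hlift b₀ hb₀
    exact ⟨x, hx⟩
  obtain ⟨S, hSne, hSK, hScard, hS⟩ :=
    exists_finset_almost_extreme hKne hKclosed hKconv (fun p hp => hp.1) hm
  have hne : ((S.image A : Finset (Space d)) : Set (Space d)).Nonempty := hSne.image A
  have hfin := (S.image A).finite_toSet
  have hupper : ∀ u, supportFn ((S.image A : Finset (Space d)) : Set (Space d)) u ≤
      supportFn (V : Set (Space d)) u := fun u => supportFn_le hne fun p hp => by
    obtain ⟨x, hx, rfl⟩ := Finset.mem_image.1 (Finset.mem_coe.1 hp)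
    exact inner_le_supportFn_of_mem_convexHull hVfin u (hSK hx).2
  have hlower : ∀ u, supportFn (V : Set (Space d)) u -
      supportFn ((S.image A : Finset (Space d)) : Set (Space d)) u ≤
        4 * k / (m : ℝ) ^ 2 * ‖W u‖ := fun u => by
    obtain ⟨v, hv, hvu⟩ := exists_inner_eq_supportFn hVfin hVne u
    obtain ⟨p, hp, hpv⟩ := hlift v hv
    obtain ⟨q, hq, hpq⟩ := hS (W u) p hp fun x hx => by
      have := inner_le_supportFn_of_mem_convexHull hVfin u hx.2
      rw [← hvu, ← hpv, hA, hA] at this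
      linarith
    have h := inner_le_supportFn hfin u (Finset.mem_coe.2 (Finset.mem_image_of_mem A hq))
    rw [hA] at h
    rw [← hvu, ← hpv, hA]
    linarith
  have hW : ∀ u, ‖W u‖ ≤ k * dirWidth (V : Set (Space d)) u := fun u => by
    have hD := dirWidth_nonneg hVfin hVne u
    refine le_of_sq_le_sq ?_ (by positivity)
    rw [EuclideanSpace.norm_sq_eq]
    calc ∑ i, ‖W u i‖ ^ 2 ≤ ∑ _i : Fin k, dirWidth (V : Set (Space d)) u ^ 2 := by
          gcongr with i
          exact abs_inner_sub_le_dirWidth hVfin u (hb i) hb₀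
      _ = k * dirWidth (V : Set (Space d)) u ^ 2 := by simp
      _ ≤ (k * dirWidth (V : Set (Space d)) u) ^ 2 := by
          rw [mul_pow]
          gcongr
          exact_mod_cast Nat.le_self_pow two_ne_zero k
  refine ⟨S.image A, hSne.image A, ?_, fun u => ⟨add_le_add (hupper u) (hupper (-u)), ?_⟩⟩
  · refine Finset.card_image_le.trans (hScard.trans ?_)
    gcongr
    omega
  · have hD := dirWidth_nonneg hVfin hVne u
    have hneg : ‖W (-u)‖ = ‖W u‖ := by
      have : W (-u) = -W u := by
        ext i
        simp [W]
      rw [this, norm_neg]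
    have h1 := hlower u
    have h2 := hlower (-u)
    rw [hneg] at h2
    calc dirWidth (V : Set (Space d)) u -
          dirWidth ((S.image A : Finset (Space d)) : Set (Space d)) u
        ≤ 2 * (4 * k / (m : ℝ) ^ 2 * ‖W u‖) := by
          simp only [dirWidth]
          linarith
      _ ≤ 2 * (4 * k / (m : ℝ) ^ 2 * (k * dirWidth (V : Set (Space d)) u)) := by
          gcongr
          exact hW u
      _ = 8 * (k : ℝ) ^ 2 / (m : ℝ) ^ 2 * dirWidth (V : Set (Space d)) u := by ring
      _ ≤ 8 * (d : ℝ) ^ 2 / (m : ℝ) ^ 2 * dirWidth (V : Set (Space d)) u := by gcongr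

/-- Every finite nonempty set has an `ε`-kernel, not necessarily a subset of it, with
`O(max {1, ε ^ (-(d - 1) / 2)})` points. -/
theorem exists_kernel_card_le {d : ℕ} (V : Finset (Space d)) (hV : V.Nonempty) {ε : ℝ}
    (hε : 0 < ε) :
    ∃ S : Finset (Space d), S.Nonempty ∧
      (S.card : ℝ) ≤ ((2 * d + 1) * (3 * d + 3) ^ (d - 1) : ℝ) *
        max 1 (1 / ε ^ (((d : ℝ) - 1) / 2)) ∧
      ∀ u, (1 - ε) * dirWidth (V : Set (Space d)) u ≤ dirWidth (S : Set (Space d)) u ∧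
        dirWidth (S : Set (Space d)) u ≤ dirWidth (V : Set (Space d)) u := by
  have hVfin := V.finite_toSet
  have hVne : (V : Set (Space d)).Nonempty := hV
  have hC : (1 : ℝ) ≤ (2 * d + 1) * (3 * d + 3) ^ (d - 1) :=
    one_le_mul_of_one_le_of_one_le (by linarith [(Nat.cast_nonneg d : (0 : ℝ) ≤ d)])
      (one_le_pow₀ (by linarith [(Nat.cast_nonneg d : (0 : ℝ) ≤ d)]))
  have hmax : (1 : ℝ) ≤ max 1 (1 / ε ^ (((d : ℝ) - 1) / 2)) := le_max_left _ _
  rcases le_or_gt 1 ε with hε1 | hε1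
  · -- For `ε ≥ 1` the lower bound is at most zero, and one point suffices.
    obtain ⟨v, hv⟩ := hV
    refine ⟨{v}, Finset.singleton_nonempty v, ?_, fun u => ?_⟩
    · simpa using one_le_mul_of_one_le_of_one_le hC hmax
    · have hD := dirWidth_nonneg hVfin hVne u
      have h0 : dirWidth (({v} : Finset (Space d)) : Set (Space d)) u = 0 := by
        simp [dirWidth, supportFn]
      rw [h0]
      exact ⟨mul_nonpos_of_nonpos_of_nonneg (by linarith) hD, hD⟩
  · set r : ℝ := √ε with hr
    have hr0 : 0 < r := Real.sqrt_pos.2 hε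
    have hr1 : r ≤ 1 := Real.sqrt_le_one.2 hε1.le
    have hrsq : r ^ 2 = ε := Real.sq_sqrt hε.le
    -- The relative error `8 d² / m²` is at most `ε` because `m ≥ 3 d / √ε`.
    set m : ℕ := ⌈3 * d / r⌉₊ + 1 with hm
    have hm1 : 3 * d / r ≤ m := (Nat.le_ceil _).trans (by rw [hm]; push_cast; linarith)
    have hm2 : ((m + 1 : ℕ) : ℝ) ≤ (3 * d + 3) / r := by
      have h1 := Nat.ceil_lt_add_one (show (0 : ℝ) ≤ 3 * d / r by positivity)
      have h2 : 1 ≤ 1 / r := by rwa [le_div_iff₀ hr0, one_mul]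
      have h3 : (3 * d + 3) / r = 3 * d / r + 3 * (1 / r) := by ring
      rw [h3, hm]
      push_cast
      linarith
    obtain ⟨S, hSne, hcard, hS⟩ := exists_finset_dirWidth_sub_le V hV (m := m) (by omega)
    refine ⟨S, hSne, ?_, fun u => ⟨?_, (hS u).1⟩⟩
    · have hpow : (1 / r) ^ (d - 1) ≤ max 1 (1 / ε ^ (((d : ℝ) - 1) / 2)) := by
        -- For `d = 0` the truncated exponent `d - 1` is `0`.
        rcases Nat.eq_zero_or_pos d with rfl | hd
        · simp
        · refine le_max_of_le_right (le_of_eq ?_)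
          rw [one_div_pow, hr, Real.sqrt_eq_rpow, ← Real.rpow_natCast, ← Real.rpow_mul hε.le,
            Nat.cast_sub hd]
          congr 2
          push_cast
          ring
      have hone : (1 : ℝ) ≤ ((m + 1 : ℕ) : ℝ) ^ (d - 1) :=
        one_le_pow₀ (by push_cast; linarith [(Nat.cast_nonneg m : (0 : ℝ) ≤ m)])
      calc (S.card : ℝ) ≤ 2 * d * ((m + 1 : ℕ) : ℝ) ^ (d - 1) + 1 := by exact_mod_cast hcard
        _ ≤ (2 * d + 1) * ((m + 1 : ℕ) : ℝ) ^ (d - 1) := by linarith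
        _ ≤ (2 * d + 1) * ((3 * d + 3) / r) ^ (d - 1) := by gcongr
        _ = (2 * d + 1) * (3 * d + 3) ^ (d - 1) * (1 / r) ^ (d - 1) := by
            rw [div_eq_mul_one_div, mul_pow, mul_assoc]
        _ ≤ _ := by gcongr
    · have hm0 : (0 : ℝ) < m := by rw [hm]; positivity
      have hrel : 8 * (d : ℝ) ^ 2 / (m : ℝ) ^ 2 ≤ ε := by
        rw [div_le_iff₀ (by positivity), ← hrsq, ← mul_pow]
        have h1 : 3 * (d : ℝ) ≤ r * m := by rwa [div_le_iff₀' hr0] at hm1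
        have h2 : (3 * (d : ℝ)) ^ 2 ≤ (r * m) ^ 2 := by gcongr
        nlinarith [sq_nonneg (d : ℝ)]
      have h := mul_le_mul_of_nonneg_right hrel (dirWidth_nonneg hVfin hVne u)
      linarith [(hS u).2]

end StochasticPoints

/-! ### The polytope and the kernels of a set of stochastic points -/

theorem mainTheorem1 (d : ℕ) :
    (∀ (n : ℕ) (X : StochasticPoints.Model d n),
      (∀ u : StochasticPoints.Space d,
        StochasticPoints.dirWidth X.minkowskiSum u = X.expWidth u) ∧
      (∃ V : Finset (StochasticPoints.Space d), V.Nonempty ∧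
        X.minkowskiSum = convexHull ℝ (V : Set (StochasticPoints.Space d)) ∧
        ∀ u : StochasticPoints.Space d,
          StochasticPoints.dirWidth (V : Set (StochasticPoints.Space d)) u = X.expWidth u)) ∧
    (∃ C : ℝ, 0 < C ∧ ∀ (n : ℕ) (X : StochasticPoints.Model d n) (ε : ℝ), 0 < ε →
      ∃ S : Finset (StochasticPoints.Space d), S.Nonempty ∧
        (S.card : ℝ) ≤ C * max 1 (1 / ε ^ (((d : ℝ) - 1) / 2)) ∧
        StochasticPoints.IsExpKernel ε (S : Set (StochasticPoints.Space d)) X) := by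
  refine ⟨fun n X => ?_, (2 * d + 1) * (3 * d + 3) ^ (d - 1), by positivity,
    fun n X ε hε => ?_⟩
  · obtain ⟨V, hV, hM, hw⟩ := X.exists_finset_minkowskiSum_eq
    refine ⟨fun u => ?_, V, hV, hM, hw⟩
    rw [hM, ← hw, StochasticPoints.dirWidth,
      StochasticPoints.supportFn_convexHull V.finite_toSet hV,
      StochasticPoints.supportFn_convexHull V.finite_toSet hV, StochasticPoints.dirWidth]
  · obtain ⟨V, hV, -, hw⟩ := X.exists_finset_minkowskiSum_eq
    obtain ⟨S, hS, hcard, hkernel⟩ := StochasticPoints.exists_kernel_card_le V hV hε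
    refine ⟨S, hS, hcard, fun u => ?_⟩
    rw [← hw u]
    exact hkernel u
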